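/- **Lemma 7.2.** Let $\omega>0$, let $\operatorname{sech}=1/\cosh$, $\operatorname{cosech}=1/\sinh$, and let $\phi_\omega(y):=\sqrt{2\omega}\,\operatorname{sech}(\sqrt\omega\,y)$ be the ground state of the focusing cubic Schrödinger equation, $\phi_\omega'$ its derivative. For $y,\xi\in\mathbb R$ set $$\Psi_{1,\omega}(y,\xi):=\frac{1}{\sqrt{2\pi}}\frac{(\xi+i\sqrt\omega\tanh(\sqrt\omega y))^2}{(|\xi|-i\sqrt\omega)^2}e^{iy\xi},\qquad \Psi_{2,\omega}(y,\xi):=\frac{1}{\sqrt{2\pi}}\frac{(\sqrt\omega\,\operatorname{sech}(\sqrt\omega y))^2}{(|\xi|-i\sqrt\omega)^2}e^{iy\xi}.$$ Writing $\Psi_j(\xi_k)$ for $\Psi_{j,\omega}(y,\xi_k)$, define the quadratic spectral distributions, for $\xi_1,\xi_2\in\mathbb R$, $$\begin{aligned} \nu_{++,\omega}(\xi_1,\xi_2)&:=\int_{\mathbb R}\bigl(\Psi_1(\xi_1)\Psi_1(\xi_2)-\Psi_2(\xi_1)\Psi_2(\xi_2)\bigr)\phi_\omega(y)^2\,dy,\\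 \nu_{+-,\omega}(\xi_1,\xi_2)&:=\int_{\mathbb R}\bigl(\Psi_1(\xi_1)\Psi_2(\xi_2)-\Psi_2(\xi_1)\Psi_1(\xi_2)\bigr)\phi_\omega(y)^2\,dy,\\ \nu_{--,\omega}(\xi_1,\xi_2)&:=\int_{\mathbb R}\bigl(\Psi_2(\xi_1)\Psi_2(\xi_2)-\Psi_1(\xi_1)\Psi_1(\xi_2)\bigr)\phi_\omega(y)^2\,dy,\\ \lambda_{++,\omega}(\xi_1,\xi_2):=\lambda_{--,\omega}(\xi_1,\xi_2)&:=\int_{\mathbb R}\bigl(\Psi_1(\xi_1)\Psi_1(\xi_2)+2\Psi_1(\xi_1)\Psi_2(\xi_2)+2\Psi_2(\xi_1)\Psi_1(\xi_2)+\Psi_2(\xi_1)\Psi_2(\xi_2)\bigr)\phi_\omega(y)\phi_\omega'(y)\,dy,\\ \lambda_{+-,\omega}(\xi_1,\xi_2)&:=\int_{\mathbb R}\bigl(\Psi_1(\xi_1)\Psi_2(\xi_2)+2\Psi_1(\xi_1)\Psi_1(\xi_2)+2\Psi_2(\xi_1)\Psi_2(\xi_2)+\Psi_2(\xi_1)\Psi_1(\xi_2)\bigr)\phi_\omega(y)\phi_\omega'(y)\,dy.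 \end{aligned}$$ All these integrals converge absolutely. Let $$\kappa_\omega(\eta):=\frac{\eta}{\sqrt\omega}\operatorname{cosech}\Bigl(\frac{\pi}{2}\frac{\eta}{\sqrt\omega}\Bigr)\quad(\eta\neq0),\qquad \kappa_\omega(0):=\frac{2}{\pi}.$$ Then, for all $\eta\in\mathbb R$, $\kappa_\omega(\eta)=\frac{\sqrt\omega}{\pi}\int_{\mathbb R}e^{iy\eta}\operatorname{sech}^2(\sqrt\omega y)\,dy$ (an absolutely convergent integral), and, for all $\xi_1,\xi_2\in\mathbb R$, with $D:=(|\xi_1|-i\sqrt\omega)^2(|\xi_2|-i\sqrt\omega)^2$, $$\begin{aligned} \nu_{++,\omega}(\xi_1,\xi_2)&=(\xi_1^2+\xi_2^2+2\omega)\,\frac{\sqrt\omega}{12}\,\frac{\xi_1^2-4\xi_1\xi_2+\xi_2^2-2\omega}{D}\,\kappa_\omega(\xi_1+\xi_2),\\ \nu_{+-,\omega}(\xi_1,\xi_2)&=(\xi_1^2-\xi_2^2)\,\frac{\sqrt\omega}{12}\,\frac{\xi_1^2+2\xi_1\xi_2+\xi_2^2+4\omega}{D}\,\kappa_\omega(\xi_1+\xi_2),\\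 \nu_{--,\omega}(\xi_1,\xi_2)&=-\nu_{++,\omega}(\xi_1,\xi_2),\\ \lambda_{++,\omega}(\xi_1,\xi_2)&=(\xi_1^2+\xi_2^2+2\omega)\,\frac{-i\sqrt\omega}{12}\,\frac{\xi_1^2-\xi_1\xi_2+\xi_2^2+\omega}{D}\,(\xi_1+\xi_2)\,\kappa_\omega(\xi_1+\xi_2),\\ \lambda_{+-,\omega}(\xi_1,\xi_2)&=(\xi_1^2-\xi_2^2)\,\frac{-i\sqrt\omega}{12}\,\frac{\xi_1^2-\xi_1\xi_2+\xi_2^2+\omega}{D}\,(\xi_1-\xi_2)\,\kappa_\omega(\xi_1+\xi_2),\\ \lambda_{--,\omega}(\xi_1,\xi_2)&=\lambda_{++,\omega}(\xi_1,\xi_2). \end{aligned}$$ In particular, $\nu_{+-,\omega}$ and $\lambda_{+-,\omega}$ are divisible by the resonant phase $\xi_1^2-\xi_2^2$: each is the product of $\xi_1^2-\xi_2^2$ with a continuous function on $\mathbb R^2$. -/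

import Mathlib

open MeasureTheory

noncomputable section

namespace NullStructure

/-- Hyperbolic secant. -/
def sech (x : ℝ) : ℝ := 1 / Real.cosh x

/-- Hyperbolic cosecant (used only at nonzero arguments below). -/
def cosech (x : ℝ) : ℝ := 1 / Real.sinh x

/-- The ground state profile of the focusing cubic Schroedinger equation at frequency `ω`,
`φ_ω(y) = √(2ω) sech(√ω y)`. -/
def phi (ω y : ℝ) : ℝ := √(2 * ω) * sech (√ω * y)

/-- First component of the distorted Fourier basis element,
`Ψ_{1,ω}(y,ξ) = (2π)^{-1/2} (ξ + i√ω tanh(√ω y))² / (|ξ| - i√ω)² e^{iyξ}`. -/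
def Psi1 (ω y ξ : ℝ) : ℂ :=
  1 / ((√(2 * Real.pi) : ℝ) : ℂ) *
    (((ξ : ℂ) + Complex.I * ((√ω : ℝ) : ℂ) * ((Real.tanh (√ω * y) : ℝ) : ℂ)) ^ 2 /
      (((|ξ| : ℝ) : ℂ) - Complex.I * ((√ω : ℝ) : ℂ)) ^ 2) *
    Complex.exp (Complex.I * (y : ℂ) * (ξ : ℂ))

/-- Second component of the distorted Fourier basis element,
`Ψ_{2,ω}(y,ξ) = (2π)^{-1/2} (√ω sech(√ω y))² / (|ξ| - i√ω)² e^{iyξ}`. -/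
def Psi2 (ω y ξ : ℝ) : ℂ :=
  1 / ((√(2 * Real.pi) : ℝ) : ℂ) *
    ((((√ω : ℝ) : ℂ) * ((sech (√ω * y) : ℝ) : ℂ)) ^ 2 /
      (((|ξ| : ℝ) : ℂ) - Complex.I * ((√ω : ℝ) : ℂ)) ^ 2) *
    Complex.exp (Complex.I * (y : ℂ) * (ξ : ℂ))

/-- Integrand of `ν_{++,ω}(ξ₁,ξ₂)`. -/
def nuPPIntegrand (ω ξ₁ ξ₂ y : ℝ) : ℂ :=
  (Psi1 ω y ξ₁ * Psi1 ω y ξ₂ - Psi2 ω y ξ₁ * Psi2 ω y ξ₂) * ((phi ω y : ℝ) : ℂ) ^ 2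

/-- Integrand of `ν_{+-,ω}(ξ₁,ξ₂)`. -/
def nuPMIntegrand (ω ξ₁ ξ₂ y : ℝ) : ℂ :=
  (Psi1 ω y ξ₁ * Psi2 ω y ξ₂ - Psi2 ω y ξ₁ * Psi1 ω y ξ₂) * ((phi ω y : ℝ) : ℂ) ^ 2

/-- Integrand of `ν_{--,ω}(ξ₁,ξ₂)`. -/
def nuMMIntegrand (ω ξ₁ ξ₂ y : ℝ) : ℂ :=
  (Psi2 ω y ξ₁ * Psi2 ω y ξ₂ - Psi1 ω y ξ₁ * Psi1 ω y ξ₂) * ((phi ω y : ℝ) : ℂ) ^ 2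

/-- Integrand of `λ_{++,ω}(ξ₁,ξ₂)`. -/
def lamPPIntegrand (ω ξ₁ ξ₂ y : ℝ) : ℂ :=
  (Psi1 ω y ξ₁ * Psi1 ω y ξ₂ + 2 * Psi1 ω y ξ₁ * Psi2 ω y ξ₂
      + 2 * Psi2 ω y ξ₁ * Psi1 ω y ξ₂ + Psi2 ω y ξ₁ * Psi2 ω y ξ₂)
    * ((phi ω y : ℝ) : ℂ) * ((deriv (phi ω) y : ℝ) : ℂ)

/-- Integrand of `λ_{+-,ω}(ξ₁,ξ₂)`. -/
def lamPMIntegrand (ω ξ₁ ξ₂ y : ℝ) : ℂ :=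
  (Psi1 ω y ξ₁ * Psi2 ω y ξ₂ + 2 * Psi1 ω y ξ₁ * Psi1 ω y ξ₂
      + 2 * Psi2 ω y ξ₁ * Psi2 ω y ξ₂ + Psi2 ω y ξ₁ * Psi1 ω y ξ₂)
    * ((phi ω y : ℝ) : ℂ) * ((deriv (phi ω) y : ℝ) : ℂ)

/-- Integrand of `λ_{--,ω}(ξ₁,ξ₂)`; it has the same expression as that of `λ_{++,ω}`. -/
def lamMMIntegrand (ω ξ₁ ξ₂ y : ℝ) : ℂ :=
  (Psi1 ω y ξ₁ * Psi1 ω y ξ₂ + 2 * Psi1 ω y ξ₁ * Psi2 ω y ξ₂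
      + 2 * Psi2 ω y ξ₁ * Psi1 ω y ξ₂ + Psi2 ω y ξ₁ * Psi2 ω y ξ₂)
    * ((phi ω y : ℝ) : ℂ) * ((deriv (phi ω) y : ℝ) : ℂ)

/-- The quadratic spectral distribution `ν_{++,ω}`. -/
def nuPP (ω ξ₁ ξ₂ : ℝ) : ℂ := ∫ y : ℝ, nuPPIntegrand ω ξ₁ ξ₂ y

/-- The quadratic spectral distribution `ν_{+-,ω}`. -/
def nuPM (ω ξ₁ ξ₂ : ℝ) : ℂ := ∫ y : ℝ, nuPMIntegrand ω ξ₁ ξ₂ y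

/-- The quadratic spectral distribution `ν_{--,ω}`. -/
def nuMM (ω ξ₁ ξ₂ : ℝ) : ℂ := ∫ y : ℝ, nuMMIntegrand ω ξ₁ ξ₂ y

/-- The quadratic spectral distribution `λ_{++,ω}`. -/
def lamPP (ω ξ₁ ξ₂ : ℝ) : ℂ := ∫ y : ℝ, lamPPIntegrand ω ξ₁ ξ₂ y

/-- The quadratic spectral distribution `λ_{+-,ω}`. -/
def lamPM (ω ξ₁ ξ₂ : ℝ) : ℂ := ∫ y : ℝ, lamPMIntegrand ω ξ₁ ξ₂ y

/-- The quadratic spectral distribution `λ_{--,ω}`. -/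
def lamMM (ω ξ₁ ξ₂ : ℝ) : ℂ := ∫ y : ℝ, lamMMIntegrand ω ξ₁ ξ₂ y

/-- `κ_ω(η) = (η/√ω) cosech(πη/(2√ω))`, with its limit `2/π` at the removable
singularity `η = 0`. -/
def kappa (ω η : ℝ) : ℝ :=
  if η = 0 then 2 / Real.pi else η / √ω * cosech (Real.pi / 2 * (η / √ω))

/-- The common denominator `(|ξ₁| - i√ω)² (|ξ₂| - i√ω)²`. -/
def denom (ω ξ₁ ξ₂ : ℝ) : ℂ :=
  (((|ξ₁| : ℝ) : ℂ) - Complex.I * ((√ω : ℝ) : ℂ)) ^ 2 *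
    (((|ξ₂| : ℝ) : ℂ) - Complex.I * ((√ω : ℝ) : ℂ)) ^ 2

end NullStructure

end

namespace NullStructure

/-! Put a = √ω, T = tanh(ay), u = iξ₁, v = iξ₂, η = ξ₁ + ξ₂. Up to constants and exponentials, Ψ₁(ξ)
is (aT - iξ)² and Ψ₂(ξ) is a²(1 - T²), while φ² = 2a² sech²(ay) and φφ' = -aTφ². Hence every
integrand is a constant times e^{iyη} sech²(ay) times a polynomial in T of degree at most five, and
only the moments Mₙ = ∫ e^{iyη} sech²(ay) Tⁿ dy are needed.

Integration by parts (`integral_expSechTanh_succ`) makes each Mₙ an explicit multiple of M₀, and M₀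
is a Beta integral under x = (1 + T)/2, evaluated by the reflection formula (`integral_expSech`); it
equals (π/a) κ_ω(η). What remains is polynomial algebra in u, v, a (the `sum_coeff` lemmas). The
resonant phase comes out as an explicit factor of the result, and the quotient is continuous because
the denominator never vanishes and κ_ω is continuous. -/

/-- The modulated weight `e^{iyη} sech²(ay) tanhⁿ(ay)`. -/
noncomputable def expSechTanh (a η : ℝ) (n : ℕ) (y : ℝ) : ℂ :=
  Complex.exp (Complex.I * (y : ℂ) * (η : ℂ)) * ((sech (a * y) : ℝ) : ℂ) ^ 2 *
    ((Real.tanh (a * y) : ℝ) : ℂ) ^ n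

/-! ### Calculus of sech and tanh, and bounds on the weights -/

theorem sech_sq (x : ℝ) : sech x ^ 2 = 1 - Real.tanh x ^ 2 := by
  have h := (Real.cosh_pos x).ne'
  rw [sech, Real.tanh_eq_sinh_div_cosh]
  field_simp
  linarith [Real.cosh_sq x]

theorem sech_pos (x : ℝ) : 0 < sech x := one_div_pos.2 (Real.cosh_pos x)

theorem hasDerivAt_sech (x : ℝ) : HasDerivAt sech (-(sech x * Real.tanh x)) x := by
  have h := (Real.cosh_pos x).ne'
  have := (hasDerivAt_const x (1 : ℝ)).fun_div (Real.hasDerivAt_cosh x) h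
  refine this.congr_deriv ?_
  rw [sech, Real.tanh_eq_sinh_div_cosh]
  field_simp
  ring

theorem hasDerivAt_tanh (x : ℝ) : HasDerivAt Real.tanh (sech x ^ 2) x := by
  have h := (Real.cosh_pos x).ne'
  have := (Real.hasDerivAt_sinh x).fun_div (Real.hasDerivAt_cosh x) h
  rw [show Real.tanh = fun x => Real.sinh x / Real.cosh x from
    funext Real.tanh_eq_sinh_div_cosh]
  refine this.congr_deriv ?_
  rw [sech]
  field_simp
  linarith [Real.cosh_sq x]

theorem continuous_sech : Continuous sech :=
  continuous_iff_continuousAt.2 fun x => (hasDerivAt_sech x).continuousAt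

theorem continuous_tanh : Continuous Real.tanh :=
  continuous_iff_continuousAt.2 fun x => (hasDerivAt_tanh x).continuousAt

theorem continuous_expSechTanh (a η : ℝ) (n : ℕ) : Continuous (expSechTanh a η n) := by
  have h1 := continuous_sech
  have h2 := continuous_tanh
  unfold expSechTanh
  fun_prop

theorem norm_expSechTanh_le (a η : ℝ) (n : ℕ) (y : ℝ) :
    ‖expSechTanh a η n y‖ ≤ sech (a * y) ^ 2 := by
  have h1 : ‖Complex.exp (Complex.I * (y : ℂ) * (η : ℂ))‖ = 1 := by
    rw [Complex.norm_exp]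
    simp
  rw [expSechTanh, norm_mul, norm_mul, h1, norm_pow, norm_pow, Complex.norm_real,
    Complex.norm_real, one_mul, Real.norm_eq_abs, Real.norm_eq_abs, sq_abs]
  exact mul_le_of_le_one_right (sq_nonneg _)
    (pow_le_one₀ (abs_nonneg _) (Real.abs_tanh_lt_one _).le)

theorem hasDerivAt_tanh_mul (a y : ℝ) :
    HasDerivAt (fun y => Real.tanh (a * y)) (a * sech (a * y) ^ 2) y := by
  have := (hasDerivAt_tanh (a * y)).comp y ((hasDerivAt_id y).const_mul a)
  refine this.congr_deriv ?_
  ring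

/-! ### The zeroth moment as a Beta integral -/

/-- The logistic substitution `x = (1 + tanh(ay))/2`, which maps `ℝ` onto `(0,1)`. -/
theorem image_logistic {a : ℝ} (ha : 0 < a) :
    (fun y => (1 + Real.tanh (a * y)) / 2) '' Set.univ = Set.Ioo 0 1 := by
  ext x
  simp only [Set.image_univ, Set.mem_range, Set.mem_Ioo]
  constructor
  · rintro ⟨y, rfl⟩
    have h1 := Real.tanh_lt_one (a * y)
    have h2 := Real.neg_one_lt_tanh (a * y)
    constructor <;> linarith
  · rintro ⟨h0, h1⟩
    refine ⟨Real.artanh (2 * x - 1) / a, ?_⟩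
    rw [mul_div_cancel₀ _ ha.ne', Real.tanh_artanh ⟨by linarith, by linarith⟩]
    ring

theorem injOn_logistic {a : ℝ} (ha : 0 < a) :
    Set.InjOn (fun y => (1 + Real.tanh (a * y)) / 2) Set.univ := by
  intro x _ y _ h
  have h' : Real.tanh (a * x) = Real.tanh (a * y) := by
    simp only at h
    linarith
  exact mul_left_cancel₀ ha.ne' (Real.tanh_injective h')

theorem hasDerivWithinAt_logistic (a y : ℝ) :
    HasDerivWithinAt (fun y => (1 + Real.tanh (a * y)) / 2) (a / 2 * sech (a * y) ^ 2)
      Set.univ y := by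
  refine ((((hasDerivAt_tanh_mul a y).const_add 1).div_const 2).congr_deriv ?_).hasDerivWithinAt
  ring

/-- With x = (1 + tanh(ay))/2 one has log(x/(1 - x)) = 2ay, so x^{it}(1 - x)^{-it} is a pure
oscillation. The exponents keep the shape s - 1 of the Beta integrand. -/
theorem logistic_cpow_mul (a t y : ℝ) :
    (((1 + Real.tanh (a * y)) / 2 : ℝ) : ℂ) ^ (1 + Complex.I * t - 1) *
      (1 - (((1 + Real.tanh (a * y)) / 2 : ℝ) : ℂ)) ^ (1 - Complex.I * t - 1) =
    Complex.exp (Complex.I * y * ((2 * a * t : ℝ) : ℂ)) := by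
  have h1 := Real.tanh_lt_one (a * y)
  have h2 := Real.neg_one_lt_tanh (a * y)
  set T := Real.tanh (a * y) with hT
  have hx : 0 < (1 + T) / 2 := by linarith
  have hx' : 0 < (1 - T) / 2 := by linarith
  have hlog : Real.log ((1 + T) / 2) - Real.log ((1 - T) / 2) = 2 * (a * y) := by
    rw [← Real.log_div hx.ne' hx'.ne', div_div_div_cancel_right₀ two_ne_zero]
    -- The logarithm of (1 + T)/(1 - T) is twice artanh T, and artanh inverts tanh.
    have := Real.artanh_eq_half_log (x := T) ⟨h2.le, h1.le⟩
    rw [hT, Real.artanh_tanh, ← hT] at this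
    linarith
  have e : (1 - (((1 + T) / 2 : ℝ) : ℂ)) = (((1 - T) / 2 : ℝ) : ℂ) := by
    push_cast
    ring
  rw [e, Complex.cpow_def_of_ne_zero (by exact_mod_cast hx.ne'),
    Complex.cpow_def_of_ne_zero (by exact_mod_cast hx'.ne'), ← Complex.exp_add,
    ← Complex.ofReal_log hx.le, ← Complex.ofReal_log hx'.le]
  congr 1
  have hlog' : ((Real.log ((1 + T) / 2) : ℝ) : ℂ) - ((Real.log ((1 - T) / 2) : ℝ) : ℂ) =
      2 * (a * y) := by
    exact_mod_cast hlog
  push_cast at hlog' ⊢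
  linear_combination (Complex.I * t) * hlog'

theorem logistic_jacobian_smul {a : ℝ} (ha : 0 < a) (t y : ℝ) :
    |a / 2 * sech (a * y) ^ 2| •
      ((((1 + Real.tanh (a * y)) / 2 : ℝ) : ℂ) ^ (1 + Complex.I * t - 1) *
      (1 - (((1 + Real.tanh (a * y)) / 2 : ℝ) : ℂ)) ^ (1 - Complex.I * t - 1)) =
    (a / 2 : ℂ) * expSechTanh a (2 * a * t) 0 y := by
  rw [logistic_cpow_mul, abs_of_nonneg (by positivity), expSechTanh, Complex.real_smul]
  push_cast
  ring

/-- The weights are dominated by sech²(ay), which is 2/a times the Jacobian of the logistic map; its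
integrability is that of the constant 1 on (0,1). -/
theorem integrable_expSechTanh {a : ℝ} (ha : 0 < a) (η : ℝ) (n : ℕ) :
    Integrable (expSechTanh a η n) := by
  have hsech : Integrable fun y : ℝ => sech (a * y) ^ 2 := by
    have h := (integrableOn_image_iff_integrableOn_abs_deriv_smul MeasurableSet.univ
      (fun y _ => hasDerivWithinAt_logistic a y) (injOn_logistic ha) (fun _ => (1 : ℝ))).1
      (by rw [image_logistic ha]; simp)
    rw [integrableOn_univ] at h
    refine (h.const_mul (2 / a)).congr (Filter.Eventually.of_forall fun y => ?_)
    simp only [smul_eq_mul, mul_one]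
    rw [abs_of_nonneg (by positivity)]
    field_simp
  exact hsech.mono' (continuous_expSechTanh a η n).aestronglyMeasurable
    (Filter.Eventually.of_forall (norm_expSechTanh_le a η n))

theorem betaIntegral_eq_integral_expSech {a : ℝ} (ha : 0 < a) (t : ℝ) :
    Complex.betaIntegral (1 + Complex.I * t) (1 - Complex.I * t) =
      (a / 2 : ℂ) * ∫ y, expSechTanh a (2 * a * t) 0 y := by
  rw [Complex.betaIntegral, intervalIntegral.integral_of_le zero_le_one,
    integral_Ioc_eq_integral_Ioo, ← image_logistic ha,
    integral_image_eq_integral_abs_deriv_smul MeasurableSet.univ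
      (fun y _ => hasDerivWithinAt_logistic a y) (injOn_logistic ha), setIntegral_univ,
    ← integral_const_mul]
  exact integral_congr_ae (Filter.Eventually.of_forall fun y => logistic_jacobian_smul ha t y)

/-- Since Γ(2) = 1, the Beta value is Γ(1 + it)Γ(1 - it) = it Γ(it)Γ(1 - it), and reflection turns
this into πit / sin(πit). -/
theorem betaIntegral_one_add_one_sub {t : ℝ} (ht : t ≠ 0) :
    Complex.betaIntegral (1 + Complex.I * t) (1 - Complex.I * t) =
      ((Real.pi * t / Real.sinh (Real.pi * t) : ℝ) : ℂ) := by
  have h := Complex.Gamma_mul_Gamma_eq_betaIntegral (s := 1 + Complex.I * t)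
    (t := 1 - Complex.I * t) (by simp) (by simp)
  have hz : Complex.I * (t : ℂ) ≠ 0 := mul_ne_zero Complex.I_ne_zero (by exact_mod_cast ht)
  have hs : Real.sinh (Real.pi * t) ≠ 0 := by
    rw [Ne, Real.sinh_eq_zero]
    exact mul_ne_zero Real.pi_ne_zero ht
  have h2 : Complex.Gamma (1 + Complex.I * t + (1 - Complex.I * t)) = 1 := by
    rw [show (1 + Complex.I * (t : ℂ) + (1 - Complex.I * t)) = ((1 : ℕ) : ℂ) + 1 by
      push_cast; ring, Complex.Gamma_nat_eq_factorial]
    simp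
  rw [h2, one_mul, add_comm, Complex.Gamma_add_one _ hz, mul_assoc,
    Complex.Gamma_mul_Gamma_one_sub,
    show (Real.pi : ℂ) * (Complex.I * t) = ((Real.pi * t : ℝ) : ℂ) * Complex.I by
      push_cast; ring,
    Complex.sin_mul_I, ← Complex.ofReal_sinh] at h
  rw [add_comm, ← h]
  have hs' : ((Real.sinh (Real.pi * t) : ℝ) : ℂ) ≠ 0 := by exact_mod_cast hs
  have hI := Complex.I_ne_zero
  push_cast at hs' ⊢
  field_simp

theorem betaIntegral_one_one : Complex.betaIntegral 1 1 = 1 := by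
  rw [Complex.betaIntegral_eval_one_right (by simp)]
  simp

/-- The Fourier transform of `sech²`. -/
theorem integral_expSech {a : ℝ} (ha : 0 < a) (η : ℝ) :
    ∫ y, expSechTanh a η 0 y =
      if η = 0 then (2 / a : ℂ)
      else ((Real.pi / a * (η / a / Real.sinh (Real.pi / 2 * (η / a))) : ℝ) : ℂ) := by
  have ha' : (a : ℂ) ≠ 0 := by exact_mod_cast ha.ne'
  -- This choice of t makes the frequency 2at equal to η.
  have h := betaIntegral_eq_integral_expSech ha (η / (2 * a))
  rw [show 2 * a * (η / (2 * a)) = η by field_simp] at h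
  split_ifs with hη
  · subst hη
    simp only [zero_div, Complex.ofReal_zero, mul_zero, add_zero, sub_zero,
      betaIntegral_one_one] at h
    field_simp
    linear_combination -2 * h
  · rw [betaIntegral_one_add_one_sub (div_ne_zero hη (by positivity)),
      show Real.pi * (η / (2 * a)) = Real.pi / 2 * (η / a) by field_simp] at h
    have : ∫ y, expSechTanh a η 0 y = 2 / a * ((a / 2 : ℂ) * ∫ y, expSechTanh a η 0 y) := by
      field_simp
    rw [this, ← h]
    push_cast
    field_simp

/-! ### The kernel κ_ω -/

theorem kappa_eq_integral {ω : ℝ} (hω : 0 < ω) (η : ℝ) :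
    ((kappa ω η : ℝ) : ℂ) = ((√ω : ℝ) : ℂ) / (Real.pi : ℂ) * ∫ y, expSechTanh √ω η 0 y := by
  have ha := Real.sqrt_pos.2 hω
  have ha' : ((√ω : ℝ) : ℂ) ≠ 0 := by exact_mod_cast ha.ne'
  have hpi : (Real.pi : ℂ) ≠ 0 := by exact_mod_cast Real.pi_ne_zero
  rw [integral_expSech ha, kappa]
  split_ifs with h
  · push_cast
    field_simp
  · rw [cosech]
    push_cast
    field_simp

/-- Dominated convergence in the Fourier representation covers the removable singularity at 0
together with all other points; the dominating function is sech². -/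
theorem continuous_kappa {ω : ℝ} (hω : 0 < ω) : Continuous fun η => ((kappa ω η : ℝ) : ℂ) := by
  have ha := Real.sqrt_pos.2 hω
  simp only [kappa_eq_integral hω]
  refine continuous_const.mul (continuous_of_dominated (bound := fun y => ‖expSechTanh √ω 0 0 y‖)
    (fun η => (continuous_expSechTanh _ η 0).aestronglyMeasurable)
    (fun η => Filter.Eventually.of_forall fun y => ?_) (integrable_expSechTanh ha 0 0).norm
    (Filter.Eventually.of_forall fun y => ?_))
  · refine (norm_expSechTanh_le _ _ _ _).trans_eq ?_
    simp [expSechTanh, abs_of_pos (sech_pos _)]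
  · unfold expSechTanh
    fun_prop

/-! ### Recursion for the moments -/

/-- Writing sech⁴ = sech²(1 - tanh²) in the term from differentiating tanhⁿ keeps the derivative in
the span of the same weights. For n = 0 the truncated index n - 1 is harmless, its coefficient being
0. -/
theorem hasDerivAt_expSechTanh (a η : ℝ) (n : ℕ) (y : ℝ) :
    HasDerivAt (expSechTanh a η n)
      (Complex.I * η * expSechTanh a η n y - (n + 2) * a * expSechTanh a η (n + 1) y +
        n * a * expSechTanh a η (n - 1) y) y := by
  have hT := (hasDerivAt_tanh_mul a y).ofReal_comp
  have hS := ((hasDerivAt_sech (a * y)).comp y ((hasDerivAt_id y).const_mul a)).ofReal_comp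
  have hE : HasDerivAt (fun y : ℝ => Complex.exp (Complex.I * (y : ℂ) * (η : ℂ)))
      (Complex.exp (Complex.I * (y : ℂ) * (η : ℂ)) * (Complex.I * η)) y := by
    have := (((hasDerivAt_id y).ofReal_comp.const_mul Complex.I).mul_const (η : ℂ)).cexp
    simpa using this
  have h := (hE.fun_mul (hS.fun_pow 2)).fun_mul (hT.fun_pow n)
  refine h.congr_deriv ?_
  have hsq : ((sech (a * y) : ℝ) : ℂ) ^ 2 = 1 - ((Real.tanh (a * y) : ℝ) : ℂ) ^ 2 := by
    exact_mod_cast sech_sq (a * y)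
  simp only [expSechTanh, Function.comp_apply]
  rcases n with _ | n
  · simp
    ring
  · push_cast at hsq ⊢
    linear_combination (Complex.exp (Complex.I * (y : ℂ) * (η : ℂ)) *
      ((sech (a * y) : ℝ) : ℂ) ^ 2 * (n + 1) * Complex.tanh (a * y) ^ n * a) * hsq

/-- Integration by parts: the moments of `e^{iyη} sech²(ay)` in `tanh(ay)` obey a two-step
recursion. -/
theorem integral_expSechTanh_succ {a : ℝ} (ha : 0 < a) (η : ℝ) (n : ℕ) :
    (n + 2) * a * ∫ y, expSechTanh a η (n + 1) y =
      (Complex.I * η * ∫ y, expSechTanh a η n y) +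
        n * a * ∫ y, expSechTanh a η (n - 1) y := by
  have hi := integrable_expSechTanh ha η
  have h1 := (hi n).const_mul (Complex.I * η)
  have h2 := (hi (n + 1)).const_mul ((n + 2 : ℂ) * a)
  have h3 := (hi (n - 1)).const_mul ((n : ℂ) * a)
  -- Both the weight and its derivative are integrable, so the derivative has integral zero with no
  -- boundary term.
  have h := integral_eq_zero_of_hasDerivAt_of_integrable (hasDerivAt_expSechTanh a η n)
    ((h1.sub h2).add h3) (hi n)
  rw [integral_add (h1.sub' h2) h3, integral_sub h1 h2, integral_const_mul, integral_const_mul,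
    integral_const_mul] at h
  linear_combination -h

/-- The first six moments of `e^{iyη} sech²(ay)` in `tanh(ay)`, solved in terms of the zeroth. -/
theorem moments_eq {a : ℝ} (ha : 0 < a) (ξ₁ ξ₂ : ℝ) {u v : ℂ} (hu : u = Complex.I * ξ₁)
    (hv : v = Complex.I * ξ₂) {M : ℕ → ℂ} (hM : ∀ n, M n = ∫ y, expSechTanh a (ξ₁ + ξ₂) n y) :
    M 1 = (u + v) / (2 * a) * M 0 ∧
    M 2 = ((u + v) ^ 2 + 2 * a ^ 2) / (6 * a ^ 2) * M 0 ∧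
    M 3 = (u + v) * ((u + v) ^ 2 + 8 * a ^ 2) / (24 * a ^ 3) * M 0 ∧
    M 4 = ((u + v) ^ 4 + 20 * a ^ 2 * (u + v) ^ 2 + 24 * a ^ 4) / (120 * a ^ 4) * M 0 ∧
    M 5 = (u + v) * ((u + v) ^ 4 + 40 * a ^ 2 * (u + v) ^ 2 + 184 * a ^ 4) / (720 * a ^ 5) *
      M 0 := by
  have ha' : (a : ℂ) ≠ 0 := by exact_mod_cast ha.ne'
  have hrec : ∀ n : ℕ, (n + 2) * a * M (n + 1) = (u + v) * M n + n * a * M (n - 1) := by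
    intro n
    have h := integral_expSechTanh_succ ha (ξ₁ + ξ₂) n
    simp only [hM, hu, hv]
    rw [h]
    push_cast
    ring
  have h0 := hrec 0
  have h1 := hrec 1
  have h2 := hrec 2
  have h3 := hrec 3
  have h4 := hrec 4
  norm_num at h0 h1 h2 h3 h4
  have e1 : M 1 = (u + v) / (2 * a) * M 0 := by
    field_simp
    linear_combination h0
  have e2 : M 2 = ((u + v) ^ 2 + 2 * a ^ 2) / (6 * a ^ 2) * M 0 := by
    rw [e1] at h1
    field_simp at h1 ⊢
    linear_combination h1
  have e3 : M 3 = (u + v) * ((u + v) ^ 2 + 8 * a ^ 2) / (24 * a ^ 3) * M 0 := by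
    rw [e2, e1] at h2
    field_simp at h2 ⊢
    linear_combination h2
  have e4 : M 4 = ((u + v) ^ 4 + 20 * a ^ 2 * (u + v) ^ 2 + 24 * a ^ 4) / (120 * a ^ 4) *
      M 0 := by
    rw [e3, e2] at h3
    field_simp at h3 ⊢
    linear_combination (1 / 6) * h3
  refine ⟨e1, e2, e3, e4, ?_⟩
  rw [e4, e3] at h4
  field_simp at h4 ⊢
  linear_combination (1 / 24) * h4

/-! ### The integrands as polynomials in tanh -/

theorem ofReal_sech_sq (x : ℝ) :
    ((sech x : ℝ) : ℂ) ^ 2 = 1 - ((Real.tanh x : ℝ) : ℂ) ^ 2 := by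
  exact_mod_cast sech_sq x

/-- Factoring i out of ξ + ia tanh(ay) leaves a polynomial in tanh whose coefficients involve ξ only
through iξ, matching the iη of the recursion. -/
theorem Psi1_eq (ω y ξ : ℝ) :
    Psi1 ω y ξ = -(1 / ((√(2 * Real.pi) : ℝ) : ℂ) *
      ((((√ω : ℝ) : ℂ) * ((Real.tanh (√ω * y) : ℝ) : ℂ) - Complex.I * ξ) ^ 2 /
        (((|ξ| : ℝ) : ℂ) - Complex.I * ((√ω : ℝ) : ℂ)) ^ 2) *
      Complex.exp (Complex.I * (y : ℂ) * (ξ : ℂ))) := by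
  have h : ((ξ : ℂ) + Complex.I * ((√ω : ℝ) : ℂ) * ((Real.tanh (√ω * y) : ℝ) : ℂ)) ^ 2 =
      -(((√ω : ℝ) : ℂ) * ((Real.tanh (√ω * y) : ℝ) : ℂ) - Complex.I * ξ) ^ 2 := by
    linear_combination ((ξ : ℂ) ^ 2 + ((√ω : ℝ) : ℂ) ^ 2 *
      ((Real.tanh (√ω * y) : ℝ) : ℂ) ^ 2) * Complex.I_sq
  rw [Psi1, h]
  ring

theorem Psi2_eq (ω y ξ : ℝ) :
    Psi2 ω y ξ = 1 / ((√(2 * Real.pi) : ℝ) : ℂ) *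
      (((√ω : ℝ) : ℂ) ^ 2 * (1 - ((Real.tanh (√ω * y) : ℝ) : ℂ) ^ 2) /
        (((|ξ| : ℝ) : ℂ) - Complex.I * ((√ω : ℝ) : ℂ)) ^ 2) *
      Complex.exp (Complex.I * (y : ℂ) * (ξ : ℂ)) := by
  rw [Psi2, mul_pow, ofReal_sech_sq]

theorem phi_sq {ω : ℝ} (hω : 0 < ω) (y : ℝ) :
    ((phi ω y : ℝ) : ℂ) ^ 2 =
      2 * ((√ω : ℝ) : ℂ) ^ 2 * (1 - ((Real.tanh (√ω * y) : ℝ) : ℂ) ^ 2) := by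
  have h : phi ω y ^ 2 = 2 * √ω ^ 2 * (1 - Real.tanh (√ω * y) ^ 2) := by
    rw [phi, mul_pow, Real.sq_sqrt (by positivity), Real.sq_sqrt hω.le, sech_sq]
  exact_mod_cast h

theorem deriv_phi (ω y : ℝ) : deriv (phi ω) y = -(√ω * Real.tanh (√ω * y) * phi ω y) := by
  have h := ((hasDerivAt_sech (√ω * y)).comp y
    ((hasDerivAt_id y).const_mul √ω)).const_mul √(2 * ω)
  refine (h.deriv : deriv (phi ω) y = _).trans ?_
  rw [phi]
  ring

theorem phi_mul_deriv_phi {ω : ℝ} (hω : 0 < ω) (A : ℂ) (y : ℝ) :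
    A * ((phi ω y : ℝ) : ℂ) * ((deriv (phi ω) y : ℝ) : ℂ) =
      A * -(2 * ((√ω : ℝ) : ℂ) ^ 3 * ((Real.tanh (√ω * y) : ℝ) : ℂ) *
        (1 - ((Real.tanh (√ω * y) : ℝ) : ℂ) ^ 2)) := by
  rw [deriv_phi, Complex.ofReal_neg, Complex.ofReal_mul, Complex.ofReal_mul]
  linear_combination (-A * ((√ω : ℝ) : ℂ) * ((Real.tanh (√ω * y) : ℝ) : ℂ)) * phi_sq hω y

/-- The constant in front of all quadratic spectral integrands. -/
noncomputable def prefactor (ω ξ₁ ξ₂ : ℝ) : ℂ :=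
  (1 / ((√(2 * Real.pi) : ℝ) : ℂ)) ^ 2 * (2 * ((√ω : ℝ) : ℂ) ^ 2) / denom ω ξ₁ ξ₂

theorem prefactor_eq (ω ξ₁ ξ₂ : ℝ) :
    prefactor ω ξ₁ ξ₂ = ((√ω : ℝ) : ℂ) ^ 2 / (Real.pi * denom ω ξ₁ ξ₂) := by
  have h : (((√(2 * Real.pi) : ℝ) : ℂ)) ^ 2 = 2 * Real.pi := by
    exact_mod_cast Real.sq_sqrt (by positivity : (0 : ℝ) ≤ 2 * Real.pi)
  have hpi : (Real.pi : ℂ) ≠ 0 := by exact_mod_cast Real.pi_ne_zero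
  rw [prefactor, div_pow, h]
  field_simp

/-- The combination `∑ cₙ e^{iyη} sech²(ay) tanhⁿ(ay)` of degree five with coefficients `c`. -/
noncomputable def quinticWeight (a η : ℝ) (c : Fin 6 → ℂ) (y : ℝ) : ℂ :=
  ∑ n : Fin 6, c n * expSechTanh a η n y

theorem integrable_const_mul_quinticWeight {a : ℝ} (ha : 0 < a) (η : ℝ) (K : ℂ)
    (c : Fin 6 → ℂ) : Integrable fun y => K * quinticWeight a η c y := by
  have h : Integrable fun y => ∑ n : Fin 6, c n * expSechTanh a η n y :=
    integrable_finsetSum Finset.univ fun (n : Fin 6) _ =>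
      (integrable_expSechTanh ha η n).const_mul (c n)
  exact h.const_mul K

theorem integral_const_mul_quinticWeight {a : ℝ} (ha : 0 < a) (η : ℝ) (K : ℂ)
    (c : Fin 6 → ℂ) : ∫ y, K * quinticWeight a η c y =
      K * ∑ n : Fin 6, c n * ∫ y, expSechTanh a η n y := by
  simp only [quinticWeight, integral_const_mul]
  rw [integral_finsetSum Finset.univ fun (n : Fin 6) _ =>
    (integrable_expSechTanh ha η n).const_mul (c n)]
  simp only [integral_const_mul]

/-- The factor `e^{iy(ξ₁+ξ₂)} / (2πD)` common to all products `Ψ_j(ξ₁)Ψ_k(ξ₂)`. -/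
noncomputable def psiFactor (ω ξ₁ ξ₂ y : ℝ) : ℂ :=
  (1 / ((√(2 * Real.pi) : ℝ) : ℂ)) ^ 2 / denom ω ξ₁ ξ₂ *
    (Complex.exp (Complex.I * (y : ℂ) * (ξ₁ : ℂ)) * Complex.exp (Complex.I * (y : ℂ) * (ξ₂ : ℂ)))

theorem Psi1_mul_Psi1 (ω ξ₁ ξ₂ y : ℝ) :
    Psi1 ω y ξ₁ * Psi1 ω y ξ₂ = psiFactor ω ξ₁ ξ₂ y *
      ((((√ω : ℝ) : ℂ) * ((Real.tanh (√ω * y) : ℝ) : ℂ) - Complex.I * ξ₁) ^ 2 *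
      (((√ω : ℝ) : ℂ) * ((Real.tanh (√ω * y) : ℝ) : ℂ) - Complex.I * ξ₂) ^ 2) := by
  simp only [Psi1_eq, psiFactor, denom]
  -- The identity does not depend on the form of the denominators, so they become atoms for `ring`.
  generalize (((|ξ₁| : ℝ) : ℂ) - Complex.I * ((√ω : ℝ) : ℂ)) ^ 2 = d₁
  generalize (((|ξ₂| : ℝ) : ℂ) - Complex.I * ((√ω : ℝ) : ℂ)) ^ 2 = d₂
  ring

theorem Psi1_mul_Psi2 (ω ξ₁ ξ₂ y : ℝ) :
    Psi1 ω y ξ₁ * Psi2 ω y ξ₂ = -psiFactor ω ξ₁ ξ₂ y *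
      ((((√ω : ℝ) : ℂ) * ((Real.tanh (√ω * y) : ℝ) : ℂ) - Complex.I * ξ₁) ^ 2 *
      (((√ω : ℝ) : ℂ) ^ 2 * (1 - ((Real.tanh (√ω * y) : ℝ) : ℂ) ^ 2))) := by
  simp only [Psi1_eq, Psi2_eq, psiFactor, denom]
  generalize (((|ξ₁| : ℝ) : ℂ) - Complex.I * ((√ω : ℝ) : ℂ)) ^ 2 = d₁
  generalize (((|ξ₂| : ℝ) : ℂ) - Complex.I * ((√ω : ℝ) : ℂ)) ^ 2 = d₂
  ring

theorem Psi2_mul_Psi1 (ω ξ₁ ξ₂ y : ℝ) :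
    Psi2 ω y ξ₁ * Psi1 ω y ξ₂ = -psiFactor ω ξ₁ ξ₂ y *
      ((((√ω : ℝ) : ℂ) ^ 2 * (1 - ((Real.tanh (√ω * y) : ℝ) : ℂ) ^ 2)) *
      (((√ω : ℝ) : ℂ) * ((Real.tanh (√ω * y) : ℝ) : ℂ) - Complex.I * ξ₂) ^ 2) := by
  simp only [Psi1_eq, Psi2_eq, psiFactor, denom]
  generalize (((|ξ₁| : ℝ) : ℂ) - Complex.I * ((√ω : ℝ) : ℂ)) ^ 2 = d₁
  generalize (((|ξ₂| : ℝ) : ℂ) - Complex.I * ((√ω : ℝ) : ℂ)) ^ 2 = d₂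
  ring

theorem Psi2_mul_Psi2 (ω ξ₁ ξ₂ y : ℝ) :
    Psi2 ω y ξ₁ * Psi2 ω y ξ₂ = psiFactor ω ξ₁ ξ₂ y *
      (((√ω : ℝ) : ℂ) ^ 2 * (1 - ((Real.tanh (√ω * y) : ℝ) : ℂ) ^ 2)) ^ 2 := by
  simp only [Psi2_eq, psiFactor, denom]
  generalize (((|ξ₁| : ℝ) : ℂ) - Complex.I * ((√ω : ℝ) : ℂ)) ^ 2 = d₁
  generalize (((|ξ₂| : ℝ) : ℂ) - Complex.I * ((√ω : ℝ) : ℂ)) ^ 2 = d₂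
  ring

theorem prefactor_mul_quinticWeight (ω ξ₁ ξ₂ : ℝ) (c : Fin 6 → ℂ) (y : ℝ) :
    prefactor ω ξ₁ ξ₂ * quinticWeight √ω (ξ₁ + ξ₂) c y =
      psiFactor ω ξ₁ ξ₂ y * (2 * ((√ω : ℝ) : ℂ) ^ 2) *
      (1 - ((Real.tanh (√ω * y) : ℝ) : ℂ) ^ 2) *
      (c 0 + c 1 * ((Real.tanh (√ω * y) : ℝ) : ℂ) + c 2 * ((Real.tanh (√ω * y) : ℝ) : ℂ) ^ 2 +
        c 3 * ((Real.tanh (√ω * y) : ℝ) : ℂ) ^ 3 + c 4 * ((Real.tanh (√ω * y) : ℝ) : ℂ) ^ 4 +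
        c 5 * ((Real.tanh (√ω * y) : ℝ) : ℂ) ^ 5) := by
  rw [prefactor, psiFactor, ← Complex.exp_add, ← mul_add, quinticWeight, Fin.sum_univ_six]
  simp only [expSechTanh, ofReal_sech_sq, Complex.ofReal_add, Fin.coe_ofNat_eq_mod, Nat.reduceMod]
  ring

/-- Coefficients of the integrand of `ν_{++}`, with `u = iξ₁` and `v = iξ₂`. -/
def coeffNuPP (a u v : ℂ) : Fin 6 → ℂ :=
  ![u ^ 2 * v ^ 2 - a ^ 4, -2 * a * u * v * (u + v),
    a ^ 2 * (u ^ 2 + 4 * u * v + v ^ 2) + 2 * a ^ 4, -2 * a ^ 3 * (u + v), 0, 0]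

/-- Coefficients of the integrand of `ν_{+-}`, with `u = iξ₁` and `v = iξ₂`. -/
def coeffNuPM (a u v : ℂ) : Fin 6 → ℂ :=
  ![-a ^ 2 * (u - v) * (u + v), 2 * a ^ 3 * (u - v), a ^ 2 * (u - v) * (u + v),
    -2 * a ^ 3 * (u - v), 0, 0]

/-- Coefficients of the integrand of `λ_{++}`, with `u = iξ₁` and `v = iξ₂`. -/
def coeffLamPP (a u v : ℂ) : Fin 6 → ℂ :=
  ![0, -a * (u ^ 2 * v ^ 2 - 2 * a ^ 2 * (u ^ 2 + v ^ 2) + a ^ 4),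
    -a * (-2 * a * u * v * (u + v) + 4 * a ^ 3 * (u + v)),
    -a * (a ^ 2 * (3 * u ^ 2 + 4 * u * v + 3 * v ^ 2) - 6 * a ^ 4),
    6 * a ^ 4 * (u + v), -6 * a ^ 5]

/-- Coefficients of the integrand of `λ_{+-}`, with `u = iξ₁` and `v = iξ₂`. -/
def coeffLamPM (a u v : ℂ) : Fin 6 → ℂ :=
  ![0, -a * (2 * u ^ 2 * v ^ 2 - a ^ 2 * (u ^ 2 + v ^ 2) + 2 * a ^ 4),
    -a * (-4 * a * u * v * (u + v) + 2 * a ^ 3 * (u + v)),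
    -a * (a ^ 2 * (3 * u ^ 2 + 8 * u * v + 3 * v ^ 2) - 6 * a ^ 4),
    6 * a ^ 4 * (u + v), -6 * a ^ 5]

theorem nuPPIntegrand_eq {ω : ℝ} (hω : 0 < ω) (ξ₁ ξ₂ : ℝ) :
    nuPPIntegrand ω ξ₁ ξ₂ = fun y => prefactor ω ξ₁ ξ₂ * quinticWeight √ω (ξ₁ + ξ₂)
      (coeffNuPP (√ω : ℝ) (Complex.I * ξ₁) (Complex.I * ξ₂)) y := by
  funext y
  rw [nuPPIntegrand, phi_sq hω, prefactor_mul_quinticWeight]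
  simp only [Psi1_mul_Psi1, Psi2_mul_Psi2, coeffNuPP,
    Matrix.cons_val]
  ring

theorem nuPMIntegrand_eq {ω : ℝ} (hω : 0 < ω) (ξ₁ ξ₂ : ℝ) :
    nuPMIntegrand ω ξ₁ ξ₂ = fun y => prefactor ω ξ₁ ξ₂ * quinticWeight √ω (ξ₁ + ξ₂)
      (coeffNuPM (√ω : ℝ) (Complex.I * ξ₁) (Complex.I * ξ₂)) y := by
  funext y
  rw [nuPMIntegrand, phi_sq hω, prefactor_mul_quinticWeight]
  simp only [Psi1_mul_Psi2, Psi2_mul_Psi1, coeffNuPM,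
    Matrix.cons_val]
  ring

theorem lamPPIntegrand_eq {ω : ℝ} (hω : 0 < ω) (ξ₁ ξ₂ : ℝ) :
    lamPPIntegrand ω ξ₁ ξ₂ = fun y => prefactor ω ξ₁ ξ₂ * quinticWeight √ω (ξ₁ + ξ₂)
      (coeffLamPP (√ω : ℝ) (Complex.I * ξ₁) (Complex.I * ξ₂)) y := by
  funext y
  rw [lamPPIntegrand, phi_mul_deriv_phi hω, prefactor_mul_quinticWeight]
  -- Reassociating the factor 2 exposes the products of two Ψ's to the rewriting lemmas.
  simp only [mul_assoc (2 : ℂ), Psi1_mul_Psi1, Psi1_mul_Psi2,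
    Psi2_mul_Psi1, Psi2_mul_Psi2, coeffLamPP,
    Matrix.cons_val]
  ring

theorem lamPMIntegrand_eq {ω : ℝ} (hω : 0 < ω) (ξ₁ ξ₂ : ℝ) :
    lamPMIntegrand ω ξ₁ ξ₂ = fun y => prefactor ω ξ₁ ξ₂ * quinticWeight √ω (ξ₁ + ξ₂)
      (coeffLamPM (√ω : ℝ) (Complex.I * ξ₁) (Complex.I * ξ₂)) y := by
  funext y
  rw [lamPMIntegrand, phi_mul_deriv_phi hω, prefactor_mul_quinticWeight]
  simp only [mul_assoc (2 : ℂ), Psi1_mul_Psi1, Psi1_mul_Psi2,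
    Psi2_mul_Psi1, Psi2_mul_Psi2, coeffLamPM,
    Matrix.cons_val]
  ring

theorem nuMMIntegrand_eq (ω ξ₁ ξ₂ : ℝ) :
    nuMMIntegrand ω ξ₁ ξ₂ = fun y => -nuPPIntegrand ω ξ₁ ξ₂ y := by
  funext y
  rw [nuMMIntegrand, nuPPIntegrand]
  ring

/-- If the moments of `c` reduce to the factor `r`, the integral is `r` times the zeroth moment,
expressed through `κ_ω`. -/
theorem integral_prefactor_mul_quinticWeight {ω : ℝ} (hω : 0 < ω) (ξ₁ ξ₂ : ℝ)
    {c : Fin 6 → ℂ} {r : ℂ}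
    (h : ∑ n : Fin 6, c n * ∫ y, expSechTanh √ω (ξ₁ + ξ₂) n y =
      r * ∫ y, expSechTanh √ω (ξ₁ + ξ₂) 0 y) :
    ∫ y, prefactor ω ξ₁ ξ₂ * quinticWeight √ω (ξ₁ + ξ₂) c y =
      ((√ω : ℝ) : ℂ) * r / denom ω ξ₁ ξ₂ * ((kappa ω (ξ₁ + ξ₂) : ℝ) : ℂ) := by
  rw [integral_const_mul_quinticWeight (Real.sqrt_pos.2 hω), h, kappa_eq_integral hω,
    prefactor_eq]
  ring

/-! ### Summation of the moments -/

theorem sum_coeffNuPP {a : ℝ} (ha : 0 < a) (ξ₁ ξ₂ : ℝ) :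
    ∑ n : Fin 6, coeffNuPP a (Complex.I * ξ₁) (Complex.I * ξ₂) n *
        ∫ y, expSechTanh a (ξ₁ + ξ₂) n y =
      (((ξ₁ : ℂ) ^ 2 + (ξ₂ : ℂ) ^ 2 + 2 * (a : ℂ) ^ 2) *
        ((ξ₁ : ℂ) ^ 2 - 4 * ((ξ₁ : ℂ) * (ξ₂ : ℂ)) + (ξ₂ : ℂ) ^ 2 - 2 * (a : ℂ) ^ 2) / 12) *
        ∫ y, expSechTanh a (ξ₁ + ξ₂) 0 y := by
  have ha' : (a : ℂ) ≠ 0 := by exact_mod_cast ha.ne'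
  -- Here u, v and M are opaque. On the right ξ₁, ξ₂ occur only through their squares and product,
  -- so after substitution no i is left and the claim is an identity in u, v, a.
  obtain ⟨u, hu⟩ : ∃ u, u = Complex.I * (ξ₁ : ℂ) := ⟨_, rfl⟩
  obtain ⟨v, hv⟩ : ∃ v, v = Complex.I * (ξ₂ : ℂ) := ⟨_, rfl⟩
  obtain ⟨M, hM⟩ : ∃ M : ℕ → ℂ, ∀ n, M n = ∫ y, expSechTanh a (ξ₁ + ξ₂) n y :=
    ⟨_, fun _ => rfl⟩
  obtain ⟨h1, h2, h3, h4, h5⟩ := moments_eq ha ξ₁ ξ₂ hu hv hM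
  have hx : (ξ₁ : ℂ) = -(Complex.I * u) := by
    rw [hu, ← mul_assoc, Complex.I_mul_I]
    ring
  have hy : (ξ₂ : ℂ) = -(Complex.I * v) := by
    rw [hv, ← mul_assoc, Complex.I_mul_I]
    ring
  have hxx : (ξ₁ : ℂ) ^ 2 = -u ^ 2 := by
    linear_combination ((ξ₁ : ℂ) - Complex.I * u) * hx + u ^ 2 * Complex.I_sq
  have hyy : (ξ₂ : ℂ) ^ 2 = -v ^ 2 := by
    linear_combination ((ξ₂ : ℂ) - Complex.I * v) * hy + v ^ 2 * Complex.I_sq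
  have hxy : (ξ₁ : ℂ) * (ξ₂ : ℂ) = -(u * v) := by
    rw [hx, hy]
    linear_combination u * v * Complex.I_sq
  simp only [← hM]
  rw [Fin.sum_univ_six]
  simp only [← hu, ← hv, coeffNuPP, Matrix.cons_val, Fin.coe_ofNat_eq_mod, Nat.reduceMod]
  simp only [h1, h2, h3, h4, h5, mul_assoc (4 : ℂ), hxx, hyy, hxy]
  field_simp
  ring

/-- Origin of the null structure: antisymmetry puts u - v in every coefficient, and u + v divides
the even coefficients as well as the odd moments. -/
theorem sum_coeffNuPM {a : ℝ} (ha : 0 < a) (ξ₁ ξ₂ : ℝ) :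
    ∑ n : Fin 6, coeffNuPM a (Complex.I * ξ₁) (Complex.I * ξ₂) n *
        ∫ y, expSechTanh a (ξ₁ + ξ₂) n y =
      (((ξ₁ : ℂ) ^ 2 - (ξ₂ : ℂ) ^ 2) *
        ((ξ₁ : ℂ) ^ 2 + 2 * ((ξ₁ : ℂ) * (ξ₂ : ℂ)) + (ξ₂ : ℂ) ^ 2 + 4 * (a : ℂ) ^ 2) / 12) *
        ∫ y, expSechTanh a (ξ₁ + ξ₂) 0 y := by
  have ha' : (a : ℂ) ≠ 0 := by exact_mod_cast ha.ne'
  obtain ⟨u, hu⟩ : ∃ u, u = Complex.I * (ξ₁ : ℂ) := ⟨_, rfl⟩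
  obtain ⟨v, hv⟩ : ∃ v, v = Complex.I * (ξ₂ : ℂ) := ⟨_, rfl⟩
  obtain ⟨M, hM⟩ : ∃ M : ℕ → ℂ, ∀ n, M n = ∫ y, expSechTanh a (ξ₁ + ξ₂) n y :=
    ⟨_, fun _ => rfl⟩
  obtain ⟨h1, h2, h3, h4, h5⟩ := moments_eq ha ξ₁ ξ₂ hu hv hM
  have hx : (ξ₁ : ℂ) = -(Complex.I * u) := by
    rw [hu, ← mul_assoc, Complex.I_mul_I]
    ring
  have hy : (ξ₂ : ℂ) = -(Complex.I * v) := by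
    rw [hv, ← mul_assoc, Complex.I_mul_I]
    ring
  have hxx : (ξ₁ : ℂ) ^ 2 = -u ^ 2 := by
    linear_combination ((ξ₁ : ℂ) - Complex.I * u) * hx + u ^ 2 * Complex.I_sq
  have hyy : (ξ₂ : ℂ) ^ 2 = -v ^ 2 := by
    linear_combination ((ξ₂ : ℂ) - Complex.I * v) * hy + v ^ 2 * Complex.I_sq
  have hxy : (ξ₁ : ℂ) * (ξ₂ : ℂ) = -(u * v) := by
    rw [hx, hy]
    linear_combination u * v * Complex.I_sq
  simp only [← hM]
  rw [Fin.sum_univ_six]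
  simp only [← hu, ← hv, coeffNuPM, Matrix.cons_val, Fin.coe_ofNat_eq_mod, Nat.reduceMod]
  simp only [h1, h2, h3, h4, h5, mul_assoc (2 : ℂ), hxx, hyy, hxy]
  field_simp
  ring

theorem sum_coeffLamPP {a : ℝ} (ha : 0 < a) (ξ₁ ξ₂ : ℝ) :
    ∑ n : Fin 6, coeffLamPP a (Complex.I * ξ₁) (Complex.I * ξ₂) n *
        ∫ y, expSechTanh a (ξ₁ + ξ₂) n y =
      (((ξ₁ : ℂ) ^ 2 + (ξ₂ : ℂ) ^ 2 + 2 * (a : ℂ) ^ 2) *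
        ((ξ₁ : ℂ) ^ 2 - (ξ₁ : ℂ) * (ξ₂ : ℂ) + (ξ₂ : ℂ) ^ 2 + (a : ℂ) ^ 2) *
        -(Complex.I * (ξ₁ : ℂ) + Complex.I * (ξ₂ : ℂ)) / 12) *
        ∫ y, expSechTanh a (ξ₁ + ξ₂) 0 y := by
  have ha' : (a : ℂ) ≠ 0 := by exact_mod_cast ha.ne'
  obtain ⟨u, hu⟩ : ∃ u, u = Complex.I * (ξ₁ : ℂ) := ⟨_, rfl⟩
  obtain ⟨v, hv⟩ : ∃ v, v = Complex.I * (ξ₂ : ℂ) := ⟨_, rfl⟩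
  obtain ⟨M, hM⟩ : ∃ M : ℕ → ℂ, ∀ n, M n = ∫ y, expSechTanh a (ξ₁ + ξ₂) n y :=
    ⟨_, fun _ => rfl⟩
  obtain ⟨h1, h2, h3, h4, h5⟩ := moments_eq ha ξ₁ ξ₂ hu hv hM
  have hx : (ξ₁ : ℂ) = -(Complex.I * u) := by
    rw [hu, ← mul_assoc, Complex.I_mul_I]
    ring
  have hy : (ξ₂ : ℂ) = -(Complex.I * v) := by
    rw [hv, ← mul_assoc, Complex.I_mul_I]
    ring
  have hxx : (ξ₁ : ℂ) ^ 2 = -u ^ 2 := by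
    linear_combination ((ξ₁ : ℂ) - Complex.I * u) * hx + u ^ 2 * Complex.I_sq
  have hyy : (ξ₂ : ℂ) ^ 2 = -v ^ 2 := by
    linear_combination ((ξ₂ : ℂ) - Complex.I * v) * hy + v ^ 2 * Complex.I_sq
  have hxy : (ξ₁ : ℂ) * (ξ₂ : ℂ) = -(u * v) := by
    rw [hx, hy]
    linear_combination u * v * Complex.I_sq
  simp only [← hM]
  rw [Fin.sum_univ_six]
  simp only [← hu, ← hv, coeffLamPP, Matrix.cons_val, Fin.coe_ofNat_eq_mod, Nat.reduceMod]
  simp only [h1, h2, h3, h4, h5, hxx, hyy, hxy]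
  field_simp
  ring

/-- As before, u + v divides the even coefficients and the odd moments. The coefficients are
symmetric in u and v and need not vanish at u = v, so the factor (u - v)² appears only after the
moments are summed. -/
theorem sum_coeffLamPM {a : ℝ} (ha : 0 < a) (ξ₁ ξ₂ : ℝ) :
    ∑ n : Fin 6, coeffLamPM a (Complex.I * ξ₁) (Complex.I * ξ₂) n *
        ∫ y, expSechTanh a (ξ₁ + ξ₂) n y =
      (((ξ₁ : ℂ) ^ 2 - (ξ₂ : ℂ) ^ 2) *
        ((ξ₁ : ℂ) ^ 2 - (ξ₁ : ℂ) * (ξ₂ : ℂ) + (ξ₂ : ℂ) ^ 2 + (a : ℂ) ^ 2) *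
        -(Complex.I * (ξ₁ : ℂ) - Complex.I * (ξ₂ : ℂ)) / 12) *
        ∫ y, expSechTanh a (ξ₁ + ξ₂) 0 y := by
  have ha' : (a : ℂ) ≠ 0 := by exact_mod_cast ha.ne'
  obtain ⟨u, hu⟩ : ∃ u, u = Complex.I * (ξ₁ : ℂ) := ⟨_, rfl⟩
  obtain ⟨v, hv⟩ : ∃ v, v = Complex.I * (ξ₂ : ℂ) := ⟨_, rfl⟩
  obtain ⟨M, hM⟩ : ∃ M : ℕ → ℂ, ∀ n, M n = ∫ y, expSechTanh a (ξ₁ + ξ₂) n y :=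
    ⟨_, fun _ => rfl⟩
  obtain ⟨h1, h2, h3, h4, h5⟩ := moments_eq ha ξ₁ ξ₂ hu hv hM
  have hx : (ξ₁ : ℂ) = -(Complex.I * u) := by
    rw [hu, ← mul_assoc, Complex.I_mul_I]
    ring
  have hy : (ξ₂ : ℂ) = -(Complex.I * v) := by
    rw [hv, ← mul_assoc, Complex.I_mul_I]
    ring
  have hxx : (ξ₁ : ℂ) ^ 2 = -u ^ 2 := by
    linear_combination ((ξ₁ : ℂ) - Complex.I * u) * hx + u ^ 2 * Complex.I_sq
  have hyy : (ξ₂ : ℂ) ^ 2 = -v ^ 2 := by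
    linear_combination ((ξ₂ : ℂ) - Complex.I * v) * hy + v ^ 2 * Complex.I_sq
  have hxy : (ξ₁ : ℂ) * (ξ₂ : ℂ) = -(u * v) := by
    rw [hx, hy]
    linear_combination u * v * Complex.I_sq
  simp only [← hM]
  rw [Fin.sum_univ_six]
  simp only [← hu, ← hv, coeffLamPM, Matrix.cons_val, Fin.coe_ofNat_eq_mod, Nat.reduceMod]
  simp only [h1, h2, h3, h4, h5, hxx, hyy, hxy]
  field_simp
  ring

/-! ### Closed formulas and continuity of the quotients -/

theorem ofReal_sqrt_sq {ω : ℝ} (hω : 0 < ω) : ((√ω : ℝ) : ℂ) ^ 2 = ω := by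
  exact_mod_cast Real.sq_sqrt hω.le

theorem nuPP_eq {ω : ℝ} (hω : 0 < ω) (ξ₁ ξ₂ : ℝ) :
    nuPP ω ξ₁ ξ₂ =
      ((ξ₁ : ℂ) ^ 2 + (ξ₂ : ℂ) ^ 2 + 2 * (ω : ℂ)) * (((√ω : ℝ) : ℂ) / 12) *
        (((ξ₁ : ℂ) ^ 2 - 4 * (ξ₁ : ℂ) * (ξ₂ : ℂ) + (ξ₂ : ℂ) ^ 2 - 2 * (ω : ℂ)) /
          denom ω ξ₁ ξ₂) * ((kappa ω (ξ₁ + ξ₂) : ℝ) : ℂ) := by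
  rw [nuPP, nuPPIntegrand_eq hω, integral_prefactor_mul_quinticWeight hω ξ₁ ξ₂
    (sum_coeffNuPP (Real.sqrt_pos.2 hω) ξ₁ ξ₂), ofReal_sqrt_sq hω]
  ring

theorem nuPM_eq {ω : ℝ} (hω : 0 < ω) (ξ₁ ξ₂ : ℝ) :
    nuPM ω ξ₁ ξ₂ =
      ((ξ₁ : ℂ) ^ 2 - (ξ₂ : ℂ) ^ 2) * (((√ω : ℝ) : ℂ) / 12) *
        (((ξ₁ : ℂ) ^ 2 + 2 * (ξ₁ : ℂ) * (ξ₂ : ℂ) + (ξ₂ : ℂ) ^ 2 + 4 * (ω : ℂ)) /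
          denom ω ξ₁ ξ₂) * ((kappa ω (ξ₁ + ξ₂) : ℝ) : ℂ) := by
  rw [nuPM, nuPMIntegrand_eq hω, integral_prefactor_mul_quinticWeight hω ξ₁ ξ₂
    (sum_coeffNuPM (Real.sqrt_pos.2 hω) ξ₁ ξ₂), ofReal_sqrt_sq hω]
  ring

theorem nuMM_eq_neg_nuPP (ω ξ₁ ξ₂ : ℝ) : nuMM ω ξ₁ ξ₂ = -nuPP ω ξ₁ ξ₂ := by
  rw [nuMM, nuMMIntegrand_eq, integral_neg, nuPP]

theorem lamPP_eq {ω : ℝ} (hω : 0 < ω) (ξ₁ ξ₂ : ℝ) :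
    lamPP ω ξ₁ ξ₂ =
      ((ξ₁ : ℂ) ^ 2 + (ξ₂ : ℂ) ^ 2 + 2 * (ω : ℂ)) * (-(Complex.I * ((√ω : ℝ) : ℂ)) / 12) *
        (((ξ₁ : ℂ) ^ 2 - (ξ₁ : ℂ) * (ξ₂ : ℂ) + (ξ₂ : ℂ) ^ 2 + (ω : ℂ)) / denom ω ξ₁ ξ₂) *
        ((ξ₁ : ℂ) + (ξ₂ : ℂ)) * ((kappa ω (ξ₁ + ξ₂) : ℝ) : ℂ) := by
  rw [lamPP, lamPPIntegrand_eq hω, integral_prefactor_mul_quinticWeight hω ξ₁ ξ₂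
    (sum_coeffLamPP (Real.sqrt_pos.2 hω) ξ₁ ξ₂), ofReal_sqrt_sq hω]
  ring

theorem lamPM_eq {ω : ℝ} (hω : 0 < ω) (ξ₁ ξ₂ : ℝ) :
    lamPM ω ξ₁ ξ₂ =
      ((ξ₁ : ℂ) ^ 2 - (ξ₂ : ℂ) ^ 2) * (-(Complex.I * ((√ω : ℝ) : ℂ)) / 12) *
        (((ξ₁ : ℂ) ^ 2 - (ξ₁ : ℂ) * (ξ₂ : ℂ) + (ξ₂ : ℂ) ^ 2 + (ω : ℂ)) / denom ω ξ₁ ξ₂) *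
        ((ξ₁ : ℂ) - (ξ₂ : ℂ)) * ((kappa ω (ξ₁ + ξ₂) : ℝ) : ℂ) := by
  rw [lamPM, lamPMIntegrand_eq hω, integral_prefactor_mul_quinticWeight hω ξ₁ ξ₂
    (sum_coeffLamPM (Real.sqrt_pos.2 hω) ξ₁ ξ₂), ofReal_sqrt_sq hω]
  ring

/-- Each factor |ξ| - i√ω has imaginary part -√ω, which is nonzero. -/
theorem denom_ne_zero {ω : ℝ} (hω : 0 < ω) (ξ₁ ξ₂ : ℝ) : denom ω ξ₁ ξ₂ ≠ 0 := by
  have h : ∀ ξ : ℝ, (((|ξ| : ℝ) : ℂ) - Complex.I * ((√ω : ℝ) : ℂ)) ≠ 0 := by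
    intro ξ h0
    have := congrArg Complex.im h0
    simp at this
    exact (Real.sqrt_pos.2 hω).ne' this
  exact mul_ne_zero (pow_ne_zero 2 (h ξ₁)) (pow_ne_zero 2 (h ξ₂))

theorem continuous_denom (ω : ℝ) : Continuous fun p : ℝ × ℝ => denom ω p.1 p.2 := by
  unfold denom
  fun_prop

theorem continuous_kappa_add {ω : ℝ} (hω : 0 < ω) :
    Continuous fun p : ℝ × ℝ => ((kappa ω (p.1 + p.2) : ℝ) : ℂ) :=
  (continuous_kappa hω).comp (continuous_fst.add continuous_snd)

end NullStructure

/-- Closed formulas for the quadratic spectral distributions, and divisibility of `ν_{+-,ω}` and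
`λ_{+-,ω}` by the resonant phase `ξ₁² - ξ₂²` with quotients continuous on `ℝ²`. -/
theorem lemma7p2 (ω : ℝ) (hω : 0 < ω) :
    -- Fourier representation of `κ_ω`
    (∀ η : ℝ,
      Integrable (fun y : ℝ =>
        Complex.exp (Complex.I * (y : ℂ) * (η : ℂ)) *
          ((NullStructure.sech (√ω * y) : ℝ) : ℂ) ^ 2) ∧
      ((NullStructure.kappa ω η : ℝ) : ℂ) =
        ((√ω : ℝ) : ℂ) / (Real.pi : ℂ) *
          ∫ y : ℝ, Complex.exp (Complex.I * (y : ℂ) * (η : ℂ)) *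
            ((NullStructure.sech (√ω * y) : ℝ) : ℂ) ^ 2) ∧
    -- all defining integrals converge absolutely
    (∀ ξ₁ ξ₂ : ℝ,
      Integrable (NullStructure.nuPPIntegrand ω ξ₁ ξ₂) ∧
      Integrable (NullStructure.nuPMIntegrand ω ξ₁ ξ₂) ∧
      Integrable (NullStructure.nuMMIntegrand ω ξ₁ ξ₂) ∧
      Integrable (NullStructure.lamPPIntegrand ω ξ₁ ξ₂) ∧
      Integrable (NullStructure.lamPMIntegrand ω ξ₁ ξ₂) ∧
      Integrable (NullStructure.lamMMIntegrand ω ξ₁ ξ₂)) ∧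
    -- closed formulas
    (∀ ξ₁ ξ₂ : ℝ,
      NullStructure.nuPP ω ξ₁ ξ₂ =
        ((ξ₁ : ℂ) ^ 2 + (ξ₂ : ℂ) ^ 2 + 2 * (ω : ℂ)) * (((√ω : ℝ) : ℂ) / 12) *
          (((ξ₁ : ℂ) ^ 2 - 4 * (ξ₁ : ℂ) * (ξ₂ : ℂ) + (ξ₂ : ℂ) ^ 2 - 2 * (ω : ℂ)) /
            NullStructure.denom ω ξ₁ ξ₂) *
          ((NullStructure.kappa ω (ξ₁ + ξ₂) : ℝ) : ℂ) ∧
      NullStructure.nuPM ω ξ₁ ξ₂ =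
        ((ξ₁ : ℂ) ^ 2 - (ξ₂ : ℂ) ^ 2) * (((√ω : ℝ) : ℂ) / 12) *
          (((ξ₁ : ℂ) ^ 2 + 2 * (ξ₁ : ℂ) * (ξ₂ : ℂ) + (ξ₂ : ℂ) ^ 2 + 4 * (ω : ℂ)) /
            NullStructure.denom ω ξ₁ ξ₂) *
          ((NullStructure.kappa ω (ξ₁ + ξ₂) : ℝ) : ℂ) ∧
      NullStructure.nuMM ω ξ₁ ξ₂ = - NullStructure.nuPP ω ξ₁ ξ₂ ∧
      NullStructure.lamPP ω ξ₁ ξ₂ =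
        ((ξ₁ : ℂ) ^ 2 + (ξ₂ : ℂ) ^ 2 + 2 * (ω : ℂ)) * (-(Complex.I * ((√ω : ℝ) : ℂ)) / 12) *
          (((ξ₁ : ℂ) ^ 2 - (ξ₁ : ℂ) * (ξ₂ : ℂ) + (ξ₂ : ℂ) ^ 2 + (ω : ℂ)) /
            NullStructure.denom ω ξ₁ ξ₂) *
          ((ξ₁ : ℂ) + (ξ₂ : ℂ)) * ((NullStructure.kappa ω (ξ₁ + ξ₂) : ℝ) : ℂ) ∧
      NullStructure.lamPM ω ξ₁ ξ₂ =
        ((ξ₁ : ℂ) ^ 2 - (ξ₂ : ℂ) ^ 2) * (-(Complex.I * ((√ω : ℝ) : ℂ)) / 12) *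
          (((ξ₁ : ℂ) ^ 2 - (ξ₁ : ℂ) * (ξ₂ : ℂ) + (ξ₂ : ℂ) ^ 2 + (ω : ℂ)) /
            NullStructure.denom ω ξ₁ ξ₂) *
          ((ξ₁ : ℂ) - (ξ₂ : ℂ)) * ((NullStructure.kappa ω (ξ₁ + ξ₂) : ℝ) : ℂ) ∧
      NullStructure.lamMM ω ξ₁ ξ₂ = NullStructure.lamPP ω ξ₁ ξ₂) ∧
    -- null structure: divisibility by the resonant phase
    (∃ g : ℝ × ℝ → ℂ, Continuous g ∧
      ∀ ξ₁ ξ₂ : ℝ, NullStructure.nuPM ω ξ₁ ξ₂ = ((ξ₁ : ℂ) ^ 2 - (ξ₂ : ℂ) ^ 2) * g (ξ₁, ξ₂)) ∧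
    (∃ g : ℝ × ℝ → ℂ, Continuous g ∧
      ∀ ξ₁ ξ₂ : ℝ, NullStructure.lamPM ω ξ₁ ξ₂ = ((ξ₁ : ℂ) ^ 2 - (ξ₂ : ℂ) ^ 2) * g (ξ₁, ξ₂)) := by
  have ha := Real.sqrt_pos.2 hω
  have hW : ∀ η : ℝ, (fun y : ℝ => Complex.exp (Complex.I * (y : ℂ) * (η : ℂ)) *
      ((NullStructure.sech (√ω * y) : ℝ) : ℂ) ^ 2) = NullStructure.expSechTanh √ω η 0 := by
    intro η
    funext y
    simp [NullStructure.expSechTanh]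
  refine ⟨fun η => ?_, fun ξ₁ ξ₂ => ?_, fun ξ₁ ξ₂ => ?_, ?_, ?_⟩
  · rw [hW]
    exact ⟨NullStructure.integrable_expSechTanh ha η 0, NullStructure.kappa_eq_integral hω η⟩
  · have hI := NullStructure.integrable_const_mul_quinticWeight ha (ξ₁ + ξ₂)
      (NullStructure.prefactor ω ξ₁ ξ₂)
    have hPP := (NullStructure.nuPPIntegrand_eq hω ξ₁ ξ₂).symm ▸ hI _
    have hL := (NullStructure.lamPPIntegrand_eq hω ξ₁ ξ₂).symm ▸ hI _
    -- `hL` serves twice, since the integrands of λ₊₊ and λ₋₋ agree by definition.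
    refine ⟨hPP, (NullStructure.nuPMIntegrand_eq hω ξ₁ ξ₂).symm ▸ hI _, ?_, hL,
      (NullStructure.lamPMIntegrand_eq hω ξ₁ ξ₂).symm ▸ hI _, hL⟩
    rw [NullStructure.nuMMIntegrand_eq]
    exact hPP.neg
  · exact ⟨NullStructure.nuPP_eq hω ξ₁ ξ₂, NullStructure.nuPM_eq hω ξ₁ ξ₂,
      NullStructure.nuMM_eq_neg_nuPP ω ξ₁ ξ₂, NullStructure.lamPP_eq hω ξ₁ ξ₂,
      NullStructure.lamPM_eq hω ξ₁ ξ₂, rfl⟩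
  -- The quotient is the closed formula with the phase deleted, hence defined and continuous also
  -- where ξ₁² = ξ₂².
  · refine ⟨fun p => (((√ω : ℝ) : ℂ) / 12) *
      (((p.1 : ℂ) ^ 2 + 2 * (p.1 : ℂ) * (p.2 : ℂ) + (p.2 : ℂ) ^ 2 + 4 * (ω : ℂ)) /
        NullStructure.denom ω p.1 p.2) * ((NullStructure.kappa ω (p.1 + p.2) : ℝ) : ℂ),
      (continuous_const.mul (Continuous.div (by fun_prop) (NullStructure.continuous_denom ω)
        fun p => NullStructure.denom_ne_zero hω p.1 p.2)).mul
        (NullStructure.continuous_kappa_add hω), fun ξ₁ ξ₂ => ?_⟩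
    rw [NullStructure.nuPM_eq hω]
    ring
  · refine ⟨fun p => (-(Complex.I * ((√ω : ℝ) : ℂ)) / 12) *
      (((p.1 : ℂ) ^ 2 - (p.1 : ℂ) * (p.2 : ℂ) + (p.2 : ℂ) ^ 2 + (ω : ℂ)) /
        NullStructure.denom ω p.1 p.2) * ((p.1 : ℂ) - (p.2 : ℂ)) *
        ((NullStructure.kappa ω (p.1 + p.2) : ℝ) : ℂ),
      ((continuous_const.mul (Continuous.div (by fun_prop) (NullStructure.continuous_denom ω)
        fun p => NullStructure.denom_ne_zero hω p.1 p.2)).mul (by fun_prop)).mul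
        (NullStructure.continuous_kappa_add hω), fun ξ₁ ξ₂ => ?_⟩
    rw [NullStructure.lamPM_eq hω]
    ring
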